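/- A curve in a metric space $(X,d)$ is a continuous map $\gamma:[0,1]\to X$; its length is the supremum of $\sum_k d(\gamma(t_{k-1}),\gamma(t_k))$ over all subdivisions of $[0,1]$, and it is rectifiable if its length is finite. $(X,d)$ is geodesic if every two points $x,y\in X$ are joined by a curve of length $d(x,y)$. A geodesic is a rectifiable curve $\gamma:[0,1]\to X$ that is locally minimizing (every parameter has a neighbourhood in which the length of each subarc equals the distance between its endpoints) and has constant speed; it is minimal if its length is $d(\gamma(0),\gamma(1))$. A geodesic metric space $(X,d)$ is an Alexandrov space of nonnegative curvature if, for all $x,y,z\in X$ and every minimal geodesic $\gamma:[0,1]\to X$ from $y$ to $z$, \[ d\bigl(x,\gamma(\tfrac12)\bigr)^2\ \ge\ \tfrac12 d(x,y)^2+\tfrac12 d(x,z)^2-\tfrac14 d(y,z)^2 . \] **Corollary.** Every Alexandrov space $(X,d)$ of nonnegative curvature has Enflo type $2$: there is a constant $K\ge 1$ such that for every $N\in\mathbb N$ and every family $(x_\varepsilon)_{\varepsilon\in\{-1,1\}^N}$ of points of $X$, \[ \sum_{\varepsilon\in\{-1,1\}^N} d(x_\varepsilon,x_{-\varepsilon})^2\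 \le\ K^2\sum_{\varepsilon\sim\varepsilon'} d(x_\varepsilon,x_{\varepsilon'})^2 , \] where the sum on the right is over all ordered pairs $(\varepsilon,\varepsilon')$ of elements of $\{-1,1\}^N$ with $\sum_{i=1}^N|\varepsilon_i-\varepsilon_i'|=2$. -/

import Mathlib

/-- The length of a curve `γ : [0,1] → X` (values of `γ` outside `[0,1]` are irrelevant):
the supremum of the lengths of inscribed polygons. -/
noncomputable def curveLength {X : Type*} [MetricSpace X] (γ : ℝ → X) : ENNReal :=
  eVariationOn γ (Set.Icc 0 1)

/-- `X` is a geodesic metric space: every two points are joined by a (continuous) curve whose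
length is their distance. -/
def IsGeodesicSpace (X : Type*) [MetricSpace X] : Prop :=
  ∀ x y : X, ∃ γ : ℝ → X, ContinuousOn γ (Set.Icc 0 1) ∧ γ 0 = x ∧ γ 1 = y ∧
    curveLength γ = edist x y

/-- `γ` is locally minimizing on `[0,1]`: around every parameter, the length of each short
subarc is the distance between its endpoints. -/
def IsLocallyMinimizing {X : Type*} [MetricSpace X] (γ : ℝ → X) : Prop :=
  ∀ t ∈ Set.Icc (0 : ℝ) 1, ∃ δ > 0, ∀ a ∈ Set.Icc (0 : ℝ) 1, ∀ b ∈ Set.Icc (0 : ℝ) 1,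
    |a - t| < δ → |b - t| < δ → a ≤ b → eVariationOn γ (Set.Icc a b) = edist (γ a) (γ b)

/-- A geodesic `γ : [0,1] → X`: a rectifiable curve which is locally minimizing and has
constant speed. -/
structure IsGeodesicCurve {X : Type*} [MetricSpace X] (γ : ℝ → X) : Prop where
  continuousOn : ContinuousOn γ (Set.Icc 0 1)
  rectifiable : curveLength γ ≠ ⊤
  locallyMinimizing : IsLocallyMinimizing γ
  constantSpeed : ∃ v : NNReal, HasConstantSpeedOnWith γ (Set.Icc 0 1) v

/-- A minimal geodesic: a geodesic whose length is the distance between its endpoints. -/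
structure IsMinimalGeodesic {X : Type*} [MetricSpace X] (γ : ℝ → X) : Prop where
  isGeodesicCurve : IsGeodesicCurve γ
  length_eq : curveLength γ = edist (γ 0) (γ 1)

/-- Alexandrov spaces of nonnegative curvature. -/
structure IsAlexandrovNonneg (X : Type*) [MetricSpace X] : Prop where
  isGeodesicSpace : IsGeodesicSpace X
  midpoint_le : ∀ (x y z : X) (γ : ℝ → X), IsMinimalGeodesic γ → γ 0 = y → γ 1 = z →
    dist x (γ (1 / 2)) ^ 2 ≥
      (1 / 2) * dist x y ^ 2 + (1 / 2) * dist x z ^ 2 - (1 / 4) * dist y z ^ 2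

/-- Adjacency of two vertices `ε, ε'` of the discrete cube `{-1,1}^N`:
`∑ i, |ε i - ε' i| = 2`. The group `ℤˣ` of units of `ℤ` is `{-1,1}`. -/
def CubeAdj {N : ℕ} (ε ε' : Fin N → ℤˣ) : Prop :=
  ∑ i, |(ε i : ℤ) - (ε' i : ℤ)| = 2

instance {N : ℕ} (ε ε' : Fin N → ℤˣ) : Decidable (CubeAdj ε ε') :=
  inferInstanceAs (Decidable (∑ i, |(ε i : ℤ) - (ε' i : ℤ)| = 2))

/-- Enflo type 2. The sum on the right runs over all ordered pairs of adjacent vertices. -/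
def HasEnfloTypeTwo (X : Type*) [MetricSpace X] : Prop :=
  ∃ K : ℝ, 1 ≤ K ∧ ∀ (N : ℕ) (x : (Fin N → ℤˣ) → X),
    ∑ ε, dist (x ε) (x (-ε)) ^ 2 ≤
      K ^ 2 * ∑ ε, ∑ ε', if CubeAdj ε ε' then dist (x ε) (x ε') ^ 2 else 0

/-! Reparametrizing a shortest curve by distance gives a constant-speed one, so every pair of points
has a midpoint satisfying the curvature inequality. Iterating midpoints gives comparison points
arbitrarily close to an end of a pair.

Midpoints suffice for the variance inequality of Lang–Schroeder and Sturm: for a probability vector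
`μ` and any base point `y`, `∑ μ i * μ j * d(x i, x j)² ≤ 2 * ∑ μ i * d(x i, y)²`. If geodesics
could be prolonged beyond `y`, one would compare first variations at `y` when moving towards each
`x i`. As they need not be, `y` is replaced by a nearby point `q` on the segment to a point `z` that
almost maximizes `∑ μ i * d(x i, ·)² - c * d(·, y)²`. At `q` the directions to `y` and `z` are
opposite, so the almost maximality of `z` controls the first variation at `q` of the distance to
`y`.

On the cube, let `f k` be the average of the squared displacement over all flips of `k` of the `N`
coordinates. The variance inequality for `m` disjoint sets of `k` coordinates reads
`(1 - 1 / m) * f (2 * k) ≤ 2 * f k`. If `N = 2 ^ n`, taking `m = N / k` for `k = 1, 2, …, N / 2`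
gives `f N * ∏ (1 - 2⁻ʲ) ≤ N * f 1`, and the product is at least `1 / 4`. Dummy coordinates reduce
the general case to a power of two.
-/

open Finset
open scoped NNReal ENNReal symmDiff

/-- Metrically, `q` divides the pair `(z, y)` in the ratio `s : 1 - s`, and the squared distance
from `q` to every point is at least what Stewart's theorem gives for the corresponding point of a
Euclidean segment. -/
structure IsComparisonPoint {X : Type*} [PseudoMetricSpace X] (s : ℝ) (z y q : X) : Prop where
  dist_left : dist z q = s * dist z y
  dist_right : dist q y = (1 - s) * dist z y
  le_sq_dist : ∀ w : X, (1 - s) * dist w z ^ 2 + s * dist w y ^ 2 - s * (1 - s) * dist z y ^ 2 ≤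
    dist w q ^ 2

/-- Nonnegative curvature expressed by midpoints alone, without curves: every pair of points has a
midpoint satisfying the comparison inequality. -/
def HasCurvedMidpoints (X : Type*) [PseudoMetricSpace X] : Prop :=
  ∀ z y : X, ∃ m : X, IsComparisonPoint (1 / 2) z y m

theorem eVariationOn_Icc_eq_edist_of_edist_eq {X : Type*} [PseudoEMetricSpace X] {σ : ℝ → X}
    {v : ℝ≥0} {a b : ℝ} (hab : a ≤ b)
    (hσ : ∀ s ∈ Set.Icc a b, ∀ t ∈ Set.Icc a b, edist (σ s) (σ t) = v * edist s t) :
    eVariationOn σ (Set.Icc a b) = edist (σ a) (σ b) := by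
  have ha : a ∈ Set.Icc a b := Set.left_mem_Icc.2 hab
  have hb : b ∈ Set.Icc a b := Set.right_mem_Icc.2 hab
  refine le_antisymm ?_ (eVariationOn.edist_le σ ha hb)
  have hlip : LipschitzOnWith v σ (Set.Icc a b) := fun s hs t ht => (hσ s hs t ht).le
  have hid : eVariationOn (id : ℝ → ℝ) (Set.Icc a b) = edist a b := by
    have h := (monotone_id.monotoneOn (Set.Icc a b)).eVariationOn_eq ha hb
    rwa [Set.inter_self, id, id, ← abs_of_nonneg (sub_nonneg.2 hab), ← Real.dist_eq,
      ← edist_dist, edist_comm] at h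
  calc eVariationOn σ (Set.Icc a b)
      ≤ v * eVariationOn id (Set.Icc a b) := hlip.comp_eVariationOn_le (Set.mapsTo_id _)
    _ = edist (σ a) (σ b) := by rw [hid, hσ a ha b hb]

section ConstantSpeed

variable {X : Type*} [MetricSpace X] {σ : ℝ → X} {v : ℝ≥0}

theorem isMinimalGeodesic_of_edist_eq
    (hσ : ∀ s ∈ Set.Icc (0 : ℝ) 1, ∀ t ∈ Set.Icc (0 : ℝ) 1, edist (σ s) (σ t) = v * edist s t) :
    IsMinimalGeodesic σ := by
  have hmin : ∀ a ∈ Set.Icc (0 : ℝ) 1, ∀ b ∈ Set.Icc (0 : ℝ) 1, a ≤ b →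
      eVariationOn σ (Set.Icc a b) = edist (σ a) (σ b) := by
    intro a ha b hb hab
    have hsub := Set.Icc_subset_Icc ha.1 hb.2
    exact eVariationOn_Icc_eq_edist_of_edist_eq hab fun s hs t ht => hσ s (hsub hs) t (hsub ht)
  have hlength : curveLength σ = edist (σ 0) (σ 1) :=
    hmin 0 (Set.left_mem_Icc.2 zero_le_one) 1 (Set.right_mem_Icc.2 zero_le_one) zero_le_one
  have hlip : LipschitzOnWith v σ (Set.Icc 0 1) := fun s hs t ht => (hσ s hs t ht).le
  refine ⟨⟨hlip.continuousOn, hlength ▸ edist_ne_top _ _, fun t _ => ?_, v, ?_⟩, hlength⟩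
  · exact ⟨1, one_pos, fun a ha b hb _ _ hab => hmin a ha b hb hab⟩
  · refine hasConstantSpeedOnWith_iff_ordered.2 fun a ha b hb hab => ?_
    rw [Set.inter_eq_right.2 (Set.Icc_subset_Icc ha.1 hb.2), hmin a ha b hb hab, hσ a ha b hb,
      edist_comm, edist_dist, Real.dist_eq, abs_of_nonneg (sub_nonneg.2 hab),
      ENNReal.ofReal_mul v.coe_nonneg, ENNReal.ofReal_coe_nnreal]

theorem dist_add_dist_eq_of_curveLength_eq {γ : ℝ → X} (h : curveLength γ = edist (γ 0) (γ 1))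
    {a b : ℝ} (ha : 0 ≤ a) (hab : a ≤ b) (hb : b ≤ 1) :
    dist (γ 0) (γ a) + dist (γ a) (γ b) = dist (γ 0) (γ b) := by
  have hsubarc : ∀ {s t : ℝ}, s ≤ t → edist (γ s) (γ t) ≤ eVariationOn γ (Set.Icc s t) :=
    fun hst => eVariationOn.edist_le γ (Set.left_mem_Icc.2 hst) (Set.right_mem_Icc.2 hst)
  have hadd : ∀ {s t : ℝ}, 0 ≤ s → s ≤ t →
      eVariationOn γ (Set.Icc 0 s) + eVariationOn γ (Set.Icc s t) =
        eVariationOn γ (Set.Icc 0 t) := fun {s t} hs hst => by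
    simpa only [Set.univ_inter] using
      eVariationOn.Icc_add_Icc γ (s := Set.univ) hs hst (Set.mem_univ s)
  have hchain : edist (γ 0) (γ a) + edist (γ a) (γ b) + edist (γ b) (γ 1) ≤ edist (γ 0) (γ 1) := by
    rw [← h, curveLength, ← hadd (ha.trans hab) hb, ← hadd ha hab]
    gcongr <;> exact hsubarc ‹_›
  simp only [edist_nndist, ← ENNReal.coe_add, ENNReal.coe_le_coe, ← NNReal.coe_le_coe,
    NNReal.coe_add, coe_nndist] at hchain
  linarith [dist_triangle (γ 0) (γ b) (γ 1), dist_triangle (γ 0) (γ a) (γ b)]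

theorem IsGeodesicSpace.exists_edist_eq (hX : IsGeodesicSpace X) (y z : X) :
    ∃ σ : ℝ → X, σ 0 = y ∧ σ 1 = z ∧ ∀ s ∈ Set.Icc (0 : ℝ) 1, ∀ t ∈ Set.Icc (0 : ℝ) 1,
      edist (σ s) (σ t) = nndist y z * edist s t := by
  obtain ⟨γ, hγ, rfl, rfl, hlength⟩ := hX y z
  have hdist : ∀ a ∈ Set.Icc (0 : ℝ) 1, ∀ b ∈ Set.Icc (0 : ℝ) 1,
      dist (γ a) (γ b) = |dist (γ 0) (γ a) - dist (γ 0) (γ b)| := by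
    intro a ha b hb
    wlog hab : a ≤ b generalizing a b
    · rw [dist_comm, abs_sub_comm, this b hb a ha (le_of_not_ge hab)]
    · rw [← dist_add_dist_eq_of_curveLength_eq hlength ha.1 hab hb.2, sub_add_cancel_left, abs_neg,
        abs_of_nonneg dist_nonneg]
  -- Reparametrize by the distance from the starting point.
  have hparam : ∀ u ∈ Set.Icc (0 : ℝ) 1, ∃ t ∈ Set.Icc (0 : ℝ) 1,
      dist (γ 0) (γ t) = dist (γ 0) (γ 1) * u := by
    intro u hu
    have hcont : ContinuousOn (fun t => dist (γ 0) (γ t)) (Set.Icc 0 1) := by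
      fun_prop
    refine intermediate_value_Icc zero_le_one hcont ?_
    simp only [dist_self]
    exact ⟨mul_nonneg dist_nonneg hu.1, mul_le_of_le_one_right dist_nonneg hu.2⟩
  choose! τ hτ hdistτ using hparam
  have h0 : (0 : ℝ) ∈ Set.Icc (0 : ℝ) 1 := Set.left_mem_Icc.2 zero_le_one
  have h1 : (1 : ℝ) ∈ Set.Icc (0 : ℝ) 1 := Set.right_mem_Icc.2 zero_le_one
  refine ⟨γ ∘ τ, ?_, ?_, fun s hs t ht => ?_⟩
  · rw [eq_comm, ← dist_eq_zero, Function.comp_apply, hdistτ 0 h0, mul_zero]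
  · rw [← dist_eq_zero, Function.comp_apply, hdist _ (hτ 1 h1) _ h1, hdistτ 1 h1, mul_one,
      sub_self, abs_zero]
  · rw [Function.comp_apply, Function.comp_apply, edist_dist, hdist _ (hτ s hs) _ (hτ t ht),
      hdistτ s hs, hdistτ t ht, ← mul_sub, abs_mul, abs_of_nonneg dist_nonneg, ← Real.dist_eq,
      ENNReal.ofReal_mul dist_nonneg, ← edist_dist, ← edist_dist, edist_nndist (γ 0)]

theorem IsAlexandrovNonneg.hasCurvedMidpoints (hX : IsAlexandrovNonneg X) :
    HasCurvedMidpoints X := by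
  intro y z
  obtain ⟨σ, h0, h1, hσ⟩ := hX.isGeodesicSpace.exists_edist_eq y z
  have hdist : ∀ s ∈ Set.Icc (0 : ℝ) 1, ∀ t ∈ Set.Icc (0 : ℝ) 1,
      dist (σ s) (σ t) = dist y z * dist s t := fun s hs t ht => by
    simpa only [ENNReal.toReal_mul, ← dist_edist, ENNReal.coe_toReal, coe_nndist] using
      congrArg ENNReal.toReal (hσ s hs t ht)
  have hhalf : (1 / 2 : ℝ) ∈ Set.Icc (0 : ℝ) 1 := by constructor <;> norm_num
  refine ⟨σ (1 / 2), ?_, ?_, fun x => ?_⟩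
  · rw [← h0, hdist 0 (Set.left_mem_Icc.2 zero_le_one) _ hhalf, h0]
    norm_num [Real.dist_eq, abs_of_pos, mul_comm]
  · rw [← h1, hdist _ hhalf 1 (Set.right_mem_Icc.2 zero_le_one), h1]
    norm_num [Real.dist_eq, abs_of_pos, mul_comm]
  · have := hX.midpoint_le x y z σ (isMinimalGeodesic_of_edist_eq hσ) h0 h1
    linarith

end ConstantSpeed

section Frechet

variable {X : Type*} [PseudoMetricSpace X]

theorem IsComparisonPoint.trans {s t : ℝ} {z y q p : X} (hq : IsComparisonPoint s z y q)
    (hp : IsComparisonPoint t z q p) (ht : 0 ≤ t) : IsComparisonPoint (t * s) z y p where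
  dist_left := by rw [hp.dist_left, hq.dist_left, mul_assoc]
  dist_right := by
    have hpqy := dist_triangle p q y
    have hzpy := dist_triangle z p y
    rw [hp.dist_right, hq.dist_left, hq.dist_right] at hpqy
    rw [hp.dist_left, hq.dist_left] at hzpy
    linarith
  le_sq_dist w := by
    have hwp := hp.le_sq_dist w
    have hwq := mul_le_mul_of_nonneg_left (hq.le_sq_dist w) ht
    rw [hq.dist_left, mul_pow] at hwp
    linarith

theorem HasCurvedMidpoints.exists_isComparisonPoint (hX : HasCurvedMidpoints X) (k : ℕ) (z y : X) :
    ∃ q : X, IsComparisonPoint ((1 / 2) ^ k) z y q := by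
  induction k with
  | zero => exact ⟨y, by simp, by simp, by simp⟩
  | succ k ih =>
    obtain ⟨q, hq⟩ := ih
    obtain ⟨m, hm⟩ := hX z q
    exact ⟨m, pow_succ' (1 / 2 : ℝ) k ▸ hq.trans hm (by norm_num)⟩

variable {ι : Type*} [Fintype ι]

/-- The Fréchet function of the family `x` with weights `μ`: the weighted sum of the squared
distances to the members of the family. The weights are not normalized. -/
noncomputable def frechet (μ : ι → ℝ) (x : ι → X) (w : X) : ℝ := ∑ i, μ i * dist (x i) w ^ 2

variable {μ : ι → ℝ} {s t c η κ : ℝ} {x p : ι → X} {y z q : X}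

theorem frechet_nonneg (hμ : ∀ i, 0 ≤ μ i) (x : ι → X) (w : X) : 0 ≤ frechet μ x w :=
  sum_nonneg fun i _ => mul_nonneg (hμ i) (sq_nonneg _)

theorem sum_mul_le_sum_mul (hμ : ∀ i, 0 ≤ μ i) {f g : ι → ℝ} (h : ∀ i, f i ≤ g i) :
    ∑ i, μ i * f i ≤ ∑ i, μ i * g i :=
  sum_le_sum fun i _ => mul_le_mul_of_nonneg_left (h i) (hμ i)

theorem sum_mul_const_of_mem_stdSimplex (hμ : μ ∈ stdSimplex ℝ ι) (a : ℝ) : ∑ i, μ i * a = a := by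
  rw [← sum_mul, hμ.2, one_mul]

theorem IsComparisonPoint.le_frechet (hq : IsComparisonPoint s z y q) (hμ : μ ∈ stdSimplex ℝ ι)
    (x : ι → X) :
    (1 - s) * frechet μ x z + s * frechet μ x y - s * (1 - s) * dist z y ^ 2 ≤ frechet μ x q :=
  calc _ = ∑ i, μ i * ((1 - s) * dist (x i) z ^ 2 + s * dist (x i) y ^ 2
        - s * (1 - s) * dist z y ^ 2) := by
        simp only [mul_sub, mul_add, sum_sub_distrib, sum_add_distrib,
          sum_mul_const_of_mem_stdSimplex hμ, frechet, mul_sum, mul_left_comm]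
    _ ≤ frechet μ x q := sum_mul_le_sum_mul hμ.1 fun i => hq.le_sq_dist (x i)

theorem frechet_le_add_mul_sq_dist (hμ : μ ∈ stdSimplex ℝ ι) (hκ : 0 < κ) (x : ι → X) (y w : X) :
    frechet μ x w ≤ (1 + κ) * frechet μ x y + (1 + κ⁻¹) * dist w y ^ 2 := by
  have hyoung : ∀ i, dist (x i) w ^ 2 ≤ (1 + κ) * dist (x i) y ^ 2 + (1 + κ⁻¹) * dist w y ^ 2 := by
    intro i
    have hsq : κ⁻¹ * (κ * dist (x i) y - dist w y) ^ 2 =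
        κ * dist (x i) y ^ 2 - 2 * (dist (x i) y * dist w y) + κ⁻¹ * dist w y ^ 2 := by
      field_simp
      ring
    calc dist (x i) w ^ 2 ≤ (dist (x i) y + dist w y) ^ 2 := by
          gcongr
          exact dist_triangle_right _ _ _
      _ ≤ (dist (x i) y + dist w y) ^ 2 + κ⁻¹ * (κ * dist (x i) y - dist w y) ^ 2 :=
          le_add_of_nonneg_right (by positivity)
      _ = (1 + κ) * dist (x i) y ^ 2 + (1 + κ⁻¹) * dist w y ^ 2 := by
          rw [hsq]
          ring
  calc frechet μ x w
      ≤ ∑ i, μ i * ((1 + κ) * dist (x i) y ^ 2 + (1 + κ⁻¹) * dist w y ^ 2) :=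
        sum_mul_le_sum_mul hμ.1 hyoung
    _ = (1 + κ) * frechet μ x y + (1 + κ⁻¹) * dist w y ^ 2 := by
        simp only [mul_add, sum_add_distrib, sum_mul_const_of_mem_stdSimplex hμ, frechet, mul_sum,
          mul_left_comm]

/-- The point `z` maximizes `frechet μ x - c * d(·, y)²` up to the error `η`. The penalty keeps
such points close to `y` when `c` is large. -/
def IsAlmostMaximal (μ : ι → ℝ) (x : ι → X) (y : X) (c η : ℝ) (z : X) : Prop :=
  ∀ w, frechet μ x w - c * dist w y ^ 2 ≤ frechet μ x z - c * dist z y ^ 2 + η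

theorem exists_isAlmostMaximal (hμ : μ ∈ stdSimplex ℝ ι) (hκ : 0 < κ) (hη : 0 < η)
    (hc : 1 + κ⁻¹ ≤ c) (x : ι → X) (y : X) : ∃ z, IsAlmostMaximal μ x y c η z := by
  have hbdd : BddAbove (Set.range fun w => frechet μ x w - c * dist w y ^ 2) := by
    refine ⟨(1 + κ) * frechet μ x y, Set.forall_mem_range.2 fun w => ?_⟩
    linarith [frechet_le_add_mul_sq_dist hμ hκ x y w,
      mul_le_mul_of_nonneg_right hc (sq_nonneg (dist w y))]
  have : Nonempty X := ⟨y⟩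
  obtain ⟨z, hz⟩ := exists_lt_of_lt_ciSup (sub_lt_self (⨆ w, (frechet μ x w - c * dist w y ^ 2)) hη)
  exact ⟨z, fun w => by linarith [le_ciSup hbdd w]⟩

theorem IsAlmostMaximal.sq_dist_le (hz : IsAlmostMaximal μ x y (2 * (1 + κ⁻¹)) η z)
    (hμ : μ ∈ stdSimplex ℝ ι) (hκ : 0 < κ) : dist z y ^ 2 ≤ κ * frechet μ x y + η := by
  have hy := hz y
  have hinv : 0 ≤ κ⁻¹ * dist z y ^ 2 := by positivity
  rw [dist_self] at hy
  linarith [frechet_le_add_mul_sq_dist hμ hκ x y z]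

theorem IsAlmostMaximal.frechet_le (hz : IsAlmostMaximal μ x y (2 * (1 + κ⁻¹)) η z)
    (hμ : μ ∈ stdSimplex ℝ ι) (hκ : 0 < κ) :
    frechet μ x z ≤ (1 + 2 * κ) * frechet μ x y + η := by
  have hy := hz y
  rw [dist_self] at hy
  linarith [frechet_le_add_mul_sq_dist hμ hκ x y z]

theorem IsAlmostMaximal.frechet_comparisonPoint_le (hz : IsAlmostMaximal μ x y c η z)
    (hc : 0 ≤ c) (hq : IsComparisonPoint t z y q) (ht : 0 ≤ t) :
    frechet μ x q ≤ frechet μ x z + η := by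
  have hdist : dist q y ^ 2 ≤ dist z y ^ 2 := by
    gcongr
    rw [hq.dist_right]
    exact mul_le_of_le_one_left dist_nonneg (by linarith)
  linarith [hz q, mul_le_mul_of_nonneg_left hdist hc]

theorem le_sum_mul_frechet_comparisonPoint (hμ : μ ∈ stdSimplex ℝ ι)
    (hp : ∀ i, IsComparisonPoint s q (x i) (p i)) :
    (1 - s) ^ 2 * frechet μ x q + s * ∑ i, μ i * frechet μ x (x i) ≤
      ∑ i, μ i * frechet μ x (p i) :=
  calc _ = ∑ i, μ i * ((1 - s) * frechet μ x q + s * frechet μ x (x i)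
        - s * (1 - s) * dist q (x i) ^ 2) := by
        have hfrechet : ∑ i, μ i * dist q (x i) ^ 2 = frechet μ x q := by
          simp only [frechet, dist_comm q]
        simp only [mul_sub (μ _), mul_add (μ _), mul_left_comm (μ _) (s * (1 - s)),
          mul_left_comm (μ _) s, sum_sub_distrib, sum_add_distrib, ← mul_sum,
          sum_mul_const_of_mem_stdSimplex hμ, hfrechet]
        ring
    _ ≤ _ := sum_mul_le_sum_mul hμ.1 fun i => (hp i).le_frechet hμ x

/-- First variation: at the inner point `q` of the segment from `z` to `y` the directions of `z`
and `y` are opposite, so moving towards `a` changes `d(·, y)²` to first order by at most a multiple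
of `d(a, q)² - d(a, z)²`. -/
theorem IsComparisonPoint.mul_sq_dist_le {a r : X} (hq : IsComparisonPoint t z y q)
    (hr : IsComparisonPoint s q a r) (hs : s ≤ 1) (ht : t ≤ 1) :
    t * dist r y ^ 2 ≤ t * s ^ 2 * dist a q ^ 2
      + s * (1 - t) * (dist a q ^ 2 - dist a z ^ 2) + t * dist z y ^ 2 := by
  have hry := hq.le_sq_dist r
  have hrz := mul_le_mul_of_nonneg_left (hr.le_sq_dist z) (sub_nonneg.2 ht)
  have hslack : 0 ≤ t ^ 2 * (1 + (1 - t) * (1 - s)) * dist z y ^ 2 := by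
    have := mul_nonneg (sub_nonneg.2 ht) (sub_nonneg.2 hs)
    positivity
  rw [dist_comm r q, hr.dist_left, mul_pow, dist_comm r z] at hry
  rw [hq.dist_left, mul_pow] at hrz
  rw [dist_comm a q, dist_comm a z]
  linarith

theorem IsAlmostMaximal.mul_sum_mul_sq_dist_le (hz : IsAlmostMaximal μ x y c η z) (hc : 0 ≤ c)
    (hη : 0 ≤ η) (hμ : μ ∈ stdSimplex ℝ ι) (hq : IsComparisonPoint t z y q)
    (hp : ∀ i, IsComparisonPoint s q (x i) (p i)) (hs0 : 0 ≤ s) (hs1 : s ≤ 1) (ht0 : 0 ≤ t)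
    (ht1 : t ≤ 1) :
    t * ∑ i, μ i * dist (p i) y ^ 2 ≤
      t * s ^ 2 * frechet μ x q + s * η + t * dist z y ^ 2 := by
  have hsum : t * ∑ i, μ i * dist (p i) y ^ 2 ≤ t * s ^ 2 * frechet μ x q
      + s * (1 - t) * (frechet μ x q - frechet μ x z) + t * dist z y ^ 2 := by
    have h := sum_mul_le_sum_mul hμ.1 fun i => hq.mul_sq_dist_le (hp i) hs1 ht1
    simpa only [frechet, mul_add (μ _), mul_left_comm (μ _) t, mul_left_comm (μ _) (t * s ^ 2),
      mul_left_comm (μ _) (s * (1 - t)), mul_sub (μ _), sum_add_distrib, sum_sub_distrib,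
      ← mul_sum, sum_mul_const_of_mem_stdSimplex hμ] using h
  have hincrease : s * (1 - t) * (frechet μ x q - frechet μ x z) ≤ s * η := by
    rw [mul_assoc]
    gcongr
    nlinarith [hz.frechet_comparisonPoint_le hc hq ht0]
  linarith

theorem IsAlmostMaximal.mul_sum_frechet_le (hz : IsAlmostMaximal μ x y c η z) (hc : 0 ≤ c)
    (hη : 0 ≤ η) (hμ : μ ∈ stdSimplex ℝ ι) (hq : IsComparisonPoint t z y q)
    (hp : ∀ i, IsComparisonPoint s q (x i) (p i)) (hs0 : 0 ≤ s) (hs1 : s ≤ 1) (ht0 : 0 < t)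
    (ht1 : t ≤ 1) :
    s * ∑ i, μ i * frechet μ x (x i) ≤ (2 * s + c * s ^ 2) * (frechet μ x z + η)
      + t * (frechet μ x z + dist z y ^ 2) + (c * s / t + 1) * η := by
  have hmax : ∑ i, μ i * frechet μ x (p i) - c * ∑ i, μ i * dist (p i) y ^ 2 ≤
      frechet μ x z - c * dist z y ^ 2 + η := by
    have h := sum_mul_le_sum_mul hμ.1 fun i => hz (p i)
    simpa only [mul_sub (μ _), mul_left_comm (μ _) c, sum_sub_distrib, ← mul_sum,
      sum_mul_const_of_mem_stdSimplex hμ] using h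
  have hdist : ∑ i, μ i * dist (p i) y ^ 2 ≤
      s ^ 2 * frechet μ x q + s * η / t + dist z y ^ 2 := by
    refine le_of_mul_le_mul_left
      ((hz.mul_sum_mul_sq_dist_le hc hη hμ hq hp hs0 hs1 ht0.le ht1).trans_eq ?_) ht0
    field_simp
  have hqlower : (1 - t) * frechet μ x z - t * dist z y ^ 2 ≤ frechet μ x q := by
    have hy := mul_nonneg ht0.le (frechet_nonneg hμ.1 x y)
    have := mul_nonneg (sq_nonneg t) (sq_nonneg (dist z y))
    linarith [hq.le_frechet hμ x]
  have hqupper := hz.frechet_comparisonPoint_le hc hq ht0.le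
  have hcs := mul_nonneg hc (sq_nonneg s)
  have hq0 := mul_nonneg (sq_nonneg s) (frechet_nonneg hμ.1 x q)
  have hgain := le_sum_mul_frechet_comparisonPoint hμ hp
  have hvariation := mul_le_mul_of_nonneg_left hqupper hcs
  have hincrease := mul_le_mul_of_nonneg_left hqupper hs0
  have hpenalty := mul_le_mul_of_nonneg_left hdist hc
  rw [mul_add c, mul_add c, ← mul_div_assoc, ← mul_assoc c s η, mul_div_right_comm] at hpenalty
  linarith

open Filter Topology in
/-- The inequality of Lang–Schroeder and Sturm. -/
theorem HasCurvedMidpoints.sum_mul_frechet_le (hX : HasCurvedMidpoints X)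
    (hμ : μ ∈ stdSimplex ℝ ι) (x : ι → X) (y : X) :
    ∑ i, μ i * frechet μ x (x i) ≤ 2 * frechet μ x y := by
  set F := frechet μ x y
  -- The scales `κ`, `s = κ²`, `t = s²`, `η = s³`, with `c` of order `κ⁻¹`, make all errors vanish.
  let bound : ℝ → ℝ := fun κ => (2 + 2 * (κ + 1) * κ) * ((1 + 2 * κ) * F + 2 * κ ^ 6)
    + κ ^ 2 * ((1 + 3 * κ) * F + 2 * κ ^ 6) + (2 * (κ + 1) * κ + κ ^ 4)
  have hbound (k : ℕ) : ∑ i, μ i * frechet μ x (x i) ≤ bound ((1 / 2) ^ k) := by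
    set κ : ℝ := (1 / 2) ^ k with hκ
    have hκ0 : 0 < κ := by positivity
    have hκ1 : κ ≤ 1 := pow_le_one₀ (by norm_num) (by norm_num)
    obtain ⟨z, hz⟩ := exists_isAlmostMaximal (c := 2 * (1 + κ⁻¹)) hμ hκ0 (pow_pos hκ0 6)
      (by linarith [inv_pos.2 hκ0]) x y
    obtain ⟨q, hq⟩ := hX.exists_isComparisonPoint (k * 4) z y
    choose p hp using fun i => hX.exists_isComparisonPoint (k * 2) q (x i)
    rw [pow_mul, ← hκ] at hq
    simp only [pow_mul, ← hκ] at hp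
    have hmain := hz.mul_sum_frechet_le (by positivity) (by positivity) hμ hq hp (by positivity)
      (pow_le_one₀ hκ0.le hκ1) (by positivity) (pow_le_one₀ hκ0.le hκ1)
    refine le_of_mul_le_mul_left (hmain.trans ?_) (pow_pos hκ0 2)
    have hzF := hz.frechet_le hμ hκ0
    have hzy := hz.sq_dist_le hμ hκ0
    calc _ ≤ (2 * κ ^ 2 + 2 * (1 + κ⁻¹) * (κ ^ 2) ^ 2) * ((1 + 2 * κ) * F + κ ^ 6 + κ ^ 6)
          + κ ^ 4 * ((1 + 2 * κ) * F + κ ^ 6 + (κ * F + κ ^ 6))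
          + (2 * (1 + κ⁻¹) * κ ^ 2 / κ ^ 4 + 1) * κ ^ 6 := by gcongr
      _ = κ ^ 2 * bound κ := by
          simp only [bound]
          field_simp
          ring
  have hlim : Tendsto (fun k : ℕ => bound ((1 / 2) ^ k)) atTop (𝓝 (2 * F)) := by
    have hcont : Tendsto bound (𝓝 0) (𝓝 (2 * F)) := by
      refine Continuous.tendsto' (by fun_prop) 0 _ ?_
      simp only [bound]
      ring
    exact hcont.comp (tendsto_pow_atTop_nhds_zero_of_lt_one (by norm_num) (by norm_num))
  exact ge_of_tendsto' hlim hbound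

theorem HasCurvedMidpoints.sum_sum_sq_dist_le (hX : HasCurvedMidpoints X) (x : ι → X) (y : X) :
    ∑ i, ∑ j, dist (x i) (x j) ^ 2 ≤ 2 * Fintype.card ι * ∑ i, dist (x i) y ^ 2 := by
  rcases isEmpty_or_nonempty ι with h | h
  · simp
  have hcard : (0 : ℝ) < Fintype.card ι := by exact_mod_cast Fintype.card_pos
  have huniform : (fun _ => (Fintype.card ι : ℝ)⁻¹) ∈ stdSimplex ℝ ι :=
    ⟨fun _ => by positivity, by simp [hcard.ne']⟩
  have hmain := hX.sum_mul_frechet_le huniform x y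
  simp only [frechet, ← mul_sum] at hmain
  rw [sum_comm] at hmain
  calc ∑ i, ∑ j, dist (x i) (x j) ^ 2
      = (Fintype.card ι) ^ 2 * ((Fintype.card ι : ℝ)⁻¹ * ((Fintype.card ι : ℝ)⁻¹ *
          ∑ i, ∑ j, dist (x i) (x j) ^ 2)) := by field_simp
    _ ≤ (Fintype.card ι) ^ 2 * (2 * ((Fintype.card ι : ℝ)⁻¹ * ∑ i, dist (x i) y ^ 2)) := by gcongr
    _ = 2 * Fintype.card ι * ∑ i, dist (x i) y ^ 2 := by field_simp

end Frechet

theorem quarter_le_prod_one_sub_half_pow (n : ℕ) :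
    (1 / 4 : ℝ) ≤ ∏ i ∈ range n, (1 - (1 / 2) ^ (i + 1)) := by
  have hstrong (k : ℕ) :
      (1 / 4 : ℝ) + (1 / 2) ^ k / 4 ≤ ∏ i ∈ range (k + 1), (1 - (1 / 2) ^ (i + 1)) := by
    induction k with
    | zero => norm_num
    | succ k ih =>
      have hpos : (0 : ℝ) < (1 / 2) ^ k := by positivity
      have hle : (1 / 2 : ℝ) ^ k ≤ 1 := pow_le_one₀ (by norm_num) (by norm_num)
      rw [prod_range_succ]
      refine le_trans ?_ (mul_le_mul_of_nonneg_right ih ?_) <;>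
        simp only [pow_succ] <;> nlinarith
  rcases n with _ | k
  · norm_num
  · exact le_trans (le_add_of_nonneg_right (by positivity)) (hstrong k)

theorem exists_pairwise_disjoint_card_eq {α : Type*} [Fintype α] {m k : ℕ}
    (h : m * k ≤ Fintype.card α) :
    ∃ S : Fin m → Finset α, Pairwise (fun b b' => Disjoint (S b) (S b')) ∧ ∀ b, #(S b) = k := by
  obtain ⟨e⟩ : Nonempty (Fin m × Fin k ↪ α) :=
    Function.Embedding.nonempty_of_card_le (by simpa using h)
  refine ⟨fun b => univ.map ((Function.Embedding.sectR b (Fin k)).trans e), fun b b' hb => ?_,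
    fun b => by simp⟩
  simp only [disjoint_left, mem_map, mem_univ, true_and, not_exists]
  rintro _ ⟨j, rfl⟩ j' hj
  exact hb (congrArg Prod.fst (e.injective hj)).symm

theorem exists_perm_map_eq {α : Type*} [Finite α] {A B : Finset α} (h : #A = #B) :
    ∃ τ : Equiv.Perm α, A.map τ.toEmbedding = B := by
  classical
  cases nonempty_fintype α
  refine ⟨(equivOfCardEq h).extendSubtype, eq_of_subset_of_card_le ?_ (by rw [card_map, h])⟩
  intro j hj
  obtain ⟨i, hi, rfl⟩ := mem_map.1 hj
  exact (equivOfCardEq h).extendSubtype_mem i hi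

section SymmDiff

variable {ι κ : Type*} [DecidableEq ι] [DecidableEq κ]

/-- The variance inequality of a nonnegatively curved space for the kernel `f (A ∆ B)` on finite
sets, with base point `∅`. For points of the cube this kernel is the squared distance averaged over
all translates. -/
structure SatisfiesVarianceInequality (f : Finset ι → ℝ) : Prop where
  map_empty : f ∅ = 0
  sum_sum_symmDiff_le : ∀ (m : ℕ) (S : Fin m → Finset ι),
    ∑ b, ∑ b', f (S b ∆ S b') ≤ 2 * m * ∑ b, f (S b)

namespace SatisfiesVarianceInequality

variable {f : Finset ι → ℝ} {A B : Finset ι}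

theorem nonneg (hf : SatisfiesVarianceInequality f) (A : Finset ι) : 0 ≤ f A := by
  simpa [hf.map_empty] using hf.sum_sum_symmDiff_le 1 fun _ => A

theorem comp (hf : SatisfiesVarianceInequality f) {T : Finset κ → Finset ι} (hempty : T ∅ = ∅)
    (hsymmDiff : ∀ A B, T (A ∆ B) = T A ∆ T B) :
    SatisfiesVarianceInequality fun A => f (T A) where
  map_empty := by rw [hempty, hf.map_empty]
  sum_sum_symmDiff_le m S := by
    simpa only [hsymmDiff] using hf.sum_sum_symmDiff_le m fun b => T (S b)

theorem sum {α : Type*} [Fintype α] {f : α → Finset ι → ℝ}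
    (hf : ∀ a, SatisfiesVarianceInequality (f a)) :
    SatisfiesVarianceInequality fun A => ∑ a, f a A where
  map_empty := sum_eq_zero fun a _ => (hf a).map_empty
  sum_sum_symmDiff_le m S :=
    calc ∑ b, ∑ b', ∑ a, f a (S b ∆ S b') = ∑ a, ∑ b, ∑ b', f a (S b ∆ S b') := by
          rw [sum_comm (s := (univ : Finset α))]
          exact sum_congr rfl fun b _ => sum_comm
      _ ≤ ∑ a, 2 * m * ∑ b, f a (S b) := sum_le_sum fun a _ => (hf a).sum_sum_symmDiff_le m S
      _ = 2 * m * ∑ b, ∑ a, f a (S b) := by rw [← mul_sum, sum_comm]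

variable [Fintype ι]

theorem double_le (hf : SatisfiesVarianceInequality f)
    (hcard : ∀ A B, #A = #B → f A = f B) {m : ℕ} (hm : m ≠ 0) (hA : m * #A ≤ Fintype.card ι)
    (hB : #B = 2 * #A) : (1 - 1 / m) * f B ≤ 2 * f A := by
  obtain ⟨S, hdisjoint, hS⟩ := exists_pairwise_disjoint_card_eq hA
  have hpair (b b' : Fin m) : f (S b ∆ S b') = if b = b' then 0 else f B := by
    split_ifs with h
    · rw [h, symmDiff_self, bot_eq_empty, hf.map_empty]
    · refine hcard _ _ ?_
      rw [(hdisjoint h).symmDiff_eq_sup, sup_eq_union, card_union_of_disjoint (hdisjoint h), hS, hS,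
        hB, two_mul]
  have hsum := hf.sum_sum_symmDiff_le m S
  have hleft (b : Fin m) : ∑ b', f (S b ∆ S b') = (m - 1) * f B := by
    simp only [hpair, sum_ite, sum_const_zero, zero_add, sum_const, nsmul_eq_mul,
      filter_ne, card_erase_of_mem (mem_univ b), card_univ, Fintype.card_fin,
      Nat.cast_pred (Nat.pos_of_ne_zero hm)]
  simp only [hleft, fun b => hcard _ _ (hS b), sum_const, card_univ, Fintype.card_fin,
    nsmul_eq_mul] at hsum
  have hm' : (0 : ℝ) < m := by positivity
  refine le_of_mul_le_mul_left ?_ (pow_pos hm' 2)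
  calc (m : ℝ) ^ 2 * ((1 - 1 / m) * f B) = m * ((m - 1) * f B) := by field_simp
    _ ≤ 2 * m * (m * f A) := hsum
    _ = m ^ 2 * (2 * f A) := by ring

theorem univ_mul_prod_le (hf : SatisfiesVarianceInequality f)
    (hcard : ∀ A B, #A = #B → f A = f B) {j : ℕ} (hA : #A * 2 ^ j = Fintype.card ι) :
    f univ * ∏ i ∈ range j, (1 - (1 / 2) ^ (i + 1)) ≤ 2 ^ j * f A := by
  induction j generalizing A with
  | zero => simp [hcard univ A (by simpa [card_univ] using hA.symm)]
  | succ j ih =>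
    have hle : 2 * #A ≤ #(univ : Finset ι) := by
      rw [card_univ, ← hA, mul_comm]
      exact Nat.mul_le_mul_left _ (Nat.le_self_pow j.succ_ne_zero 2)
    obtain ⟨B, -, hB⟩ := exists_subset_card_eq hle
    have hdouble := hf.double_le hcard (m := 2 ^ (j + 1)) (by positivity)
      (by rw [mul_comm, hA]) hB
    have hfactor : (0 : ℝ) ≤ 1 - (1 / 2) ^ (j + 1) :=
      sub_nonneg.2 (pow_le_one₀ (by norm_num) (by norm_num))
    calc f univ * ∏ i ∈ range (j + 1), (1 - (1 / 2) ^ (i + 1))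
        = f univ * (∏ i ∈ range j, (1 - (1 / 2) ^ (i + 1))) * (1 - (1 / 2) ^ (j + 1)) := by
          rw [prod_range_succ, mul_assoc]
      _ ≤ 2 ^ j * f B * (1 - (1 / 2) ^ (j + 1)) := by
          have hcardB : #B * 2 ^ j = Fintype.card ι := by rw [hB, ← hA, pow_succ]; ring
          exact mul_le_mul_of_nonneg_right (ih hcardB) hfactor
      _ = 2 ^ j * ((1 - 1 / (2 ^ (j + 1) : ℕ)) * f B) := by
          push_cast
          rw [one_div_pow]
          ring
      _ ≤ 2 ^ j * (2 * f A) := by gcongr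
      _ = 2 ^ (j + 1) * f A := by ring

theorem univ_le_of_card_invariant (hf : SatisfiesVarianceInequality f)
    (hcard : ∀ A B, #A = #B → f A = f B) {n : ℕ} (hι : Fintype.card ι = 2 ^ n) :
    f univ ≤ 4 * ∑ i, f {i} := by
  obtain ⟨i⟩ : Nonempty ι := Fintype.card_pos_iff.1 (hι ▸ by positivity)
  have hprod := mul_le_mul_of_nonneg_left (quarter_le_prod_one_sub_half_pow n) (hf.nonneg univ)
  have hmain := hf.univ_mul_prod_le hcard (A := {i}) (j := n) (by simp [hι])
  have hsum : ∑ j, f {j} = 2 ^ n * f {i} := by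
    rw [sum_congr rfl fun j _ => hcard {j} {i} (by simp)]
    simp [hι]
  linarith

theorem univ_le_of_card_eq_two_pow (hf : SatisfiesVarianceInequality f) {n : ℕ}
    (hι : Fintype.card ι = 2 ^ n) : f univ ≤ 4 * ∑ i, f {i} := by
  have hsymm : SatisfiesVarianceInequality fun A => ∑ σ : Equiv.Perm ι, f (A.map σ.toEmbedding) :=
    sum fun σ => hf.comp (Finset.map_empty _) fun A B => by
      simp only [map_eq_image, image_symmDiff _ _ (Equiv.injective _), Equiv.coe_toEmbedding]
  have hcard (A B : Finset ι) (hAB : #A = #B) : ∑ σ : Equiv.Perm ι, f (A.map σ.toEmbedding) =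
      ∑ σ : Equiv.Perm ι, f (B.map σ.toEmbedding) := by
    obtain ⟨τ, rfl⟩ := exists_perm_map_eq hAB
    simp only [map_map, ← Equiv.trans_toEmbedding]
    exact (Equiv.sum_comp (Equiv.mulRight τ) fun σ => f (A.map σ.toEmbedding)).symm
  have hmain := hsymm.univ_le_of_card_invariant hcard hι
  have hsingletons : ∑ i, ∑ σ : Equiv.Perm ι, f (({i} : Finset ι).map σ.toEmbedding) =
      Fintype.card (Equiv.Perm ι) * ∑ i, f {i} := by
    rw [sum_comm]
    simp only [map_singleton, Equiv.coe_toEmbedding]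
    simp only [fun σ : Equiv.Perm ι => Equiv.sum_comp σ fun i => f {i}, sum_const, card_univ,
      nsmul_eq_mul]
  simp only [hsingletons, map_univ_equiv, sum_const, card_univ, nsmul_eq_mul] at hmain
  refine le_of_mul_le_mul_left (hmain.trans_eq ?_)
    (Nat.cast_pos.2 (Fintype.card_pos (α := Equiv.Perm ι)))
  ring

theorem univ_le (hf : SatisfiesVarianceInequality f) : f univ ≤ 4 * ∑ i, f {i} := by
  set N := Fintype.card ι
  have hpad : SatisfiesVarianceInequality fun A : Finset (ι ⊕ Fin (2 ^ N - N)) => f A.toLeft :=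
    hf.comp (by ext; simp) fun A B => by ext; simp [mem_symmDiff]
  have hle : N ≤ 2 ^ N := Nat.lt_two_pow_self.le
  have hcard : Fintype.card (ι ⊕ Fin (2 ^ N - N)) = 2 ^ N := by
    rw [Fintype.card_sum, Fintype.card_fin, Nat.add_sub_cancel' hle]
  have huniv : (univ : Finset (ι ⊕ Fin (2 ^ N - N))).toLeft = univ := by ext; simp
  have hinl (i : ι) : ({Sum.inl i} : Finset (ι ⊕ Fin (2 ^ N - N))).toLeft = {i} := by ext; simp
  have hinr (i) : ({Sum.inr i} : Finset (ι ⊕ Fin (2 ^ N - N))).toLeft = ∅ := by ext; simp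
  simpa only [huniv, Fintype.sum_sum_type, hinl, hinr, hf.map_empty, sum_const_zero, add_zero] using
    hpad.univ_le_of_card_eq_two_pow hcard

end SatisfiesVarianceInequality

end SymmDiff

section Cube

variable {ι : Type*} [DecidableEq ι]

/-- The vertex of the cube `{-1,1}^ι` with value `-1` exactly on `A`. Multiplication by it flips
the coordinates in `A`. -/
def signFlip (A : Finset ι) : ι → ℤˣ := fun i => if i ∈ A then -1 else 1

theorem signFlip_empty : signFlip (∅ : Finset ι) = 1 := by
  ext i
  simp [signFlip]

theorem signFlip_univ [Fintype ι] : signFlip (univ : Finset ι) = -1 := by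
  ext i
  simp [signFlip]

theorem signFlip_symmDiff (A B : Finset ι) : signFlip (A ∆ B) = signFlip A / signFlip B := by
  ext i
  by_cases hA : i ∈ A <;> by_cases hB : i ∈ B <;> simp [signFlip, mem_symmDiff, hA, hB]

theorem signFlip_injective : Function.Injective (signFlip : Finset ι → ι → ℤˣ) := by
  intro A B h
  ext i
  have := congrFun h i
  by_cases hA : i ∈ A <;> by_cases hB : i ∈ B <;> simp_all [signFlip]

variable {X : Type*} [PseudoMetricSpace X] [Fintype ι]

/-- The sum over all vertices of the cube of the squared distances by which flipping the
coordinates in `A` moves the points of the family `x`. -/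
noncomputable def flipEnergy (x : (ι → ℤˣ) → X) (A : Finset ι) : ℝ :=
  ∑ ε, dist (x (signFlip A * ε)) (x ε) ^ 2

theorem flipEnergy_symmDiff (x : (ι → ℤˣ) → X) (A B : Finset ι) :
    flipEnergy x (A ∆ B) = ∑ ε, dist (x (signFlip A * ε)) (x (signFlip B * ε)) ^ 2 := by
  rw [flipEnergy, ← Equiv.sum_comp (Equiv.mulLeft (signFlip B))]
  simp only [Equiv.coe_mulLeft, signFlip_symmDiff, ← mul_assoc, div_mul_cancel]

theorem HasCurvedMidpoints.satisfiesVarianceInequality_flipEnergy (hX : HasCurvedMidpoints X)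
    (x : (ι → ℤˣ) → X) : SatisfiesVarianceInequality (flipEnergy x) where
  map_empty := by simp [flipEnergy, signFlip_empty]
  sum_sum_symmDiff_le m S :=
    calc ∑ b, ∑ b', flipEnergy x (S b ∆ S b')
        = ∑ ε, ∑ b, ∑ b', dist (x (signFlip (S b) * ε)) (x (signFlip (S b') * ε)) ^ 2 := by
          simp only [flipEnergy_symmDiff]
          rw [sum_comm (s := (univ : Finset (ι → ℤˣ)))]
          exact sum_congr rfl fun b _ => sum_comm
      _ ≤ ∑ ε, 2 * m * ∑ b, dist (x (signFlip (S b) * ε)) (x ε) ^ 2 :=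
          sum_le_sum fun ε _ => by
            simpa only [Fintype.card_fin] using
              hX.sum_sum_sq_dist_le (fun b => x (signFlip (S b) * ε)) (x ε)
      _ = 2 * m * ∑ b, flipEnergy x (S b) := by rw [← mul_sum, sum_comm]; rfl

theorem flipEnergy_univ (x : (ι → ℤˣ) → X) :
    flipEnergy x univ = ∑ ε, dist (x ε) (x (-ε)) ^ 2 := by
  simp only [flipEnergy, signFlip_univ, neg_one_mul, dist_comm (x (-_))]

theorem cubeAdj_signFlip_singleton_mul {N : ℕ} (ε : Fin N → ℤˣ) (i : Fin N) :
    CubeAdj ε (signFlip {i} * ε) := by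
  rw [CubeAdj, sum_eq_single_of_mem i (mem_univ i) fun j _ hj => by simp [signFlip, hj]]
  rcases Int.units_eq_one_or (ε i) with h | h <;> simp [signFlip, h]

theorem sum_flipEnergy_singleton_le {N : ℕ} (x : (Fin N → ℤˣ) → X) :
    ∑ i, flipEnergy x {i} ≤ ∑ ε, ∑ ε', if CubeAdj ε ε' then dist (x ε) (x ε') ^ 2 else 0 := by
  simp only [flipEnergy]
  rw [sum_comm]
  refine sum_le_sum fun ε _ => ?_
  let neighbour : Fin N ↪ (Fin N → ℤˣ) :=
    ⟨fun i => signFlip {i} * ε, fun i j hij =>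
      singleton_injective (signFlip_injective (mul_right_cancel hij))⟩
  have hadj : univ.map neighbour ⊆ univ.filter (CubeAdj ε) := fun ε' h => by
    obtain ⟨i, -, rfl⟩ := mem_map.1 h
    exact mem_filter.2 ⟨mem_univ _, cubeAdj_signFlip_singleton_mul ε i⟩
  calc ∑ i, dist (x (signFlip {i} * ε)) (x ε) ^ 2
      = ∑ ε' ∈ univ.map neighbour, dist (x ε) (x ε') ^ 2 := by
        simp only [sum_map, dist_comm (x ε)]
        rfl
    _ ≤ ∑ ε' with CubeAdj ε ε', dist (x ε) (x ε') ^ 2 :=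
        sum_le_sum_of_subset_of_nonneg hadj fun _ _ _ => sq_nonneg _
    _ = _ := sum_filter _ _

end Cube

theorem corollary4p3_general {X : Type*} [MetricSpace X] (hX : HasCurvedMidpoints X) :
    HasEnfloTypeTwo X := by
  refine ⟨2, one_le_two, fun N x => ?_⟩
  calc ∑ ε, dist (x ε) (x (-ε)) ^ 2 = flipEnergy x univ := (flipEnergy_univ x).symm
    _ ≤ 4 * ∑ i, flipEnergy x {i} := (hX.satisfiesVarianceInequality_flipEnergy x).univ_le
    _ ≤ 4 * ∑ ε, ∑ ε', if CubeAdj ε ε' then dist (x ε) (x ε') ^ 2 else 0 := by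
        gcongr
        exact sum_flipEnergy_singleton_le x
    _ = 2 ^ 2 * ∑ ε, ∑ ε', if CubeAdj ε ε' then dist (x ε) (x ε') ^ 2 else 0 := by norm_num

theorem corollary4p3 {X : Type*} [MetricSpace X] (hX : IsAlexandrovNonneg X) :
    HasEnfloTypeTwo X :=
  corollary4p3_general hX.hasCurvedMidpoints
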